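/- Let $M\cong\mathbb Z^d$ be a lattice with dual lattice $N$, and $M_{\mathbb R}=M\otimes\mathbb R$, $N_{\mathbb R}=N\otimes\mathbb R$, with pairing $\langle\cdot,\cdot\rangle$. For a polytope $P\subset M_{\mathbb R}$ put $P^*=\{y\in N_{\mathbb R}:\langle x,y\rangle\ge -1\ \forall x\in P\}$. A lattice polytope $P$ with $0$ in its interior is reflexive if $P^*$ is also a lattice polytope. Lattice polytopes $\Delta_1,\dots,\Delta_r\subset M_{\mathbb R}$ form a centered nef-partition if $0\in\Delta_i$ for all $i$ and the Minkowski sum $\Delta_1+\dots+\Delta_r$ is reflexive; it is proper if $\dim\Delta_i>0$ for all $i$. The Cayley cone of $\Delta_1,\dots,\Delta_r$ is the cone in $M_{\mathbb R}\oplus\mathbb R^r$ generated by $\Delta_1\times e_1,\dots,\Delta_r\times e_r$. Centered nef-partitions $\Delta_1,\dots,\Delta_r$ in $M_{\mathbb R}$ and $\nabla_1,\dots,\nabla_r$ in $N_{\mathbb R}$ are dual to each other if the Cayley cone of the $\nabla_i$ is the dual of the Cayley cone of the $\Delta_i$, that is, if their Cayley polytopes are dual Gorenstein polytopes. Let $\Delta_1,\dots,\Delta_r\subset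 M_{\mathbb R}$ and $\nabla_1,\dots,\nabla_r\subset N_{\mathbb R}$ be two proper centered nef-partitions which are dual to each other. Let $\{1,\dots,r\}=I\sqcup J$ with $I\ne\emptyset\ne J$. Put $\Delta^J=\sum_{j\in J}\Delta_j$ and $\nabla_I=\mathrm{Conv}(\nabla_i: i\in I)$, let $\mathrm{lin}(\Delta^J)$ be the linear span of $\Delta^J$ and $(\Delta^J)^\perp\subseteq N_{\mathbb R}$ its annihilator. Assume that $\dim\mathrm{lin}(\Delta^J)<\dim M_{\mathbb R}$, and let $\pi:M_{\mathbb R}\to M_{\mathbb R}/\mathrm{lin}(\Delta^J)$ be the projection. The dual space of $M_{\mathbb R}/\mathrm{lin}(\Delta^J)$ is identified with $(\Delta^J)^\perp$. Then: 1. $\pi(\Delta_1),\dots,\pi(\Delta_r)$ is a centered nef-partition with respect to the lattice $\pi(M)$. 2. The dual polytope $(\pi(\Delta_1)+\dots+\pi(\Delta_r))^*$, taken in $(\Delta^J)^\perp$, is reflexive and equal to $\nabla_I\cap(\Delta^J)^\perp$, and this set is the smallest face $F$ of $\nabla_I$ that contains $0$. 3. $\nabla_1\cap F,\dots,\nabla_r\cap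 F$ is a centered nef-partition in $(\Delta^J)^\perp$, with respect to the lattice dual to $\pi(M)$, and it is the nef-partition dual to $\pi(\Delta_1),\dots,\pi(\Delta_r)$. -/

import Mathlib

open scoped Pointwise

namespace NefPartition

/-!
Throughout, the real vector space `V` plays the role of `M_ℝ`, a full-rank lattice `L` in it the
role of `M`, and `Module.Dual ℝ V` with the lattice `dualLattice L` the role of `N_ℝ` and `N`.
-/

section Polytopes

variable {V : Type*} [AddCommGroup V] [Module ℝ V]

/-- `L` is a lattice of full rank in `V`: the integral span of a finite real basis of `V`. -/
def IsLattice (L : Submodule ℤ V) : Prop :=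
  ∃ (d : ℕ) (b : Module.Basis (Fin d) ℝ V), L = Submodule.span ℤ (Set.range b)

/-- The dual lattice, embedded in the dual space: the linear forms with integral values on `L`. -/
def dualLattice (L : Submodule ℤ V) : Submodule ℤ (Module.Dual ℝ V) where
  carrier := {y | ∀ x ∈ L, ∃ n : ℤ, y x = n}
  zero_mem' := fun _ _ => ⟨0, by simp⟩
  add_mem' := by
    intro y z hy hz x hx
    obtain ⟨m, hm⟩ := hy x hx
    obtain ⟨n, hn⟩ := hz x hx
    exact ⟨m + n, by simp [hm, hn]⟩
  smul_mem' := by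
    intro c y hy x hx
    obtain ⟨m, hm⟩ := hy x hx
    exact ⟨c * m, by simp [hm]⟩

/-- `P` is a lattice polytope: the convex hull of finitely many (and at least one) lattice
points. -/
def IsLatticePolytope (L : Submodule ℤ V) (P : Set V) : Prop :=
  ∃ S : Finset V, S.Nonempty ∧ (∀ x ∈ S, x ∈ L) ∧ P = convexHull ℝ (S : Set V)

/-- The dual polytope `P^* = {y | ⟨x, y⟩ ≥ -1 for all x ∈ P}`. -/
def dualPolytope (P : Set V) : Set (Module.Dual ℝ V) :=
  {y | ∀ x ∈ P, -1 ≤ y x}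

/-- `P` is a reflexive polytope (with respect to the origin): a lattice polytope with `0` in its
interior, for the canonical topology of the finite-dimensional real vector space `V`, whose dual
polytope is also a lattice polytope. -/
structure IsReflexive (L : Submodule ℤ V) (P : Set V) : Prop where
  isLatticePolytope : IsLatticePolytope L P
  zero_mem_interior : (0 : V) ∈ @interior V (moduleTopology ℝ V) P
  dual_isLatticePolytope : IsLatticePolytope (dualLattice L) (dualPolytope P)

/-- `F` is a face of the polytope `P`: the set where some valid linear inequality `c ≤ l` of `P` is
an equality. The empty face and `P` itself are included. -/
def IsFace (P F : Set V) : Prop :=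
  ∃ (l : Module.Dual ℝ V) (c : ℝ), (∀ x ∈ P, c ≤ l x) ∧ F = {x ∈ P | l x = c}

variable {r : ℕ}

/-- The sets `Δ₁, …, Δᵣ` form a centered nef-partition with respect to the lattice `L`: they are
lattice polytopes that contain the origin and whose Minkowski sum is reflexive. (The interior
lattice point of the sum is the sum of the chosen lattice points of the summands; as all of these
are `0`, it is the origin.) -/
structure IsCenteredNefPartition (L : Submodule ℤ V) (Δ : Fin r → Set V) : Prop where
  isLattice : IsLattice L
  isLatticePolytope : ∀ i, IsLatticePolytope L (Δ i)
  zero_mem : ∀ i, (0 : V) ∈ Δ i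
  isReflexive_sum : IsReflexive L (∑ i, Δ i)

/-- All the polytopes have positive dimension. -/
def IsProper (Δ : Fin r → Set V) : Prop :=
  ∀ i, 0 < Module.finrank ℝ (vectorSpan ℝ (Δ i))

/-- The Cayley polytope `Δ₁ * ⋯ * Δᵣ`, the convex hull of the sets `Δᵢ × eᵢ` in `V × ℝ^r`. -/
def cayleyPolytope (Δ : Fin r → Set V) : Set (V × (Fin r → ℝ)) :=
  convexHull ℝ (⋃ i, Δ i ×ˢ {Pi.single i 1})

/-- The Cayley cone, the cone over the Cayley polytope. -/
def cayleyCone (Δ : Fin r → Set V) : PointedCone ℝ (V × (Fin r → ℝ)) :=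
  PointedCone.hull ℝ (cayleyPolytope Δ)

variable (V r) in
/-- The pairing `⟨(x, s), (y, t)⟩ = ⟨x, y⟩ + ∑ sᵢ tᵢ` between `M_ℝ ⊕ ℝ^r` and `N_ℝ ⊕ ℝ^r`. -/
def cayleyPairing : (V × (Fin r → ℝ)) →ₗ[ℝ] (Module.Dual ℝ V × (Fin r → ℝ)) →ₗ[ℝ] ℝ :=
  LinearMap.mk₂ ℝ (fun z w => w.1 z.1 + ∑ i, z.2 i * w.2 i)
    (by intro z z' w; simp [add_mul, Finset.sum_add_distrib]; ring)
    (by intro c z w; simp [mul_add, Finset.mul_sum, mul_assoc])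
    (by intro z w w'; simp [mul_add, Finset.sum_add_distrib]; ring)
    (by intro c z w; simp [mul_add, Finset.mul_sum, mul_left_comm])

/-- The centered nef-partitions `Δ₁, …, Δᵣ` in `M_ℝ` and `D₁, …, Dᵣ` in `N_ℝ` are dual to each
other: their Cayley polytopes are dual Gorenstein polytopes, that is, the Cayley cone of the `Dᵢ` is
the dual cone of the Cayley cone of the `Δᵢ`. The special simplices which induce the two Cayley
structures are the convex hulls of the points `0 × eᵢ`, since the nef-partitions are centered. -/
structure AreDualNefPartitions (L : Submodule ℤ V) (Δ : Fin r → Set V)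
    (D : Fin r → Set (Module.Dual ℝ V)) : Prop where
  left : IsCenteredNefPartition L Δ
  right : IsCenteredNefPartition (dualLattice L) D
  dual_cayleyCone : PointedCone.dual (cayleyPairing V r) (cayleyCone Δ) = cayleyCone D

/-- `lin(Δ^J)`, the linear span of the Minkowski sum `Δ^J` of the `Δⱼ` with `j ∈ J`. -/
def linSum (Δ : Fin r → Set V) (J : Finset (Fin r)) : Submodule ℝ V :=
  Submodule.span ℝ (∑ j ∈ J, Δ j)

/-- `D_I`, the convex hull of the union of the `Dᵢ` with `i ∈ I`. -/
def convUnion (D : Fin r → Set V) (I : Finset (Fin r)) : Set V :=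
  convexHull ℝ (⋃ i ∈ I, D i)

end Polytopes

end NefPartition

/-! Write `D i` for the dual polytopes and `p` for the projection. Unfolded as in `IsCayleyDual`,
duality of the Cayley cones says that `y + t i` is nonnegative on every `Δ i` iff `t ≥ 0` and `y` is
a sum of points `t i • d i` with `d i ∈ D i`. Hence forms in `D i` are `≥ -1` on `Δ i` and `≥ 0` on
the other `Δ k`, the dual of the sum of the `Δ i` is the convex hull of the `D i`, and the sum of
the `D i` is the dual of the convex hull of the `Δ i`.

This duality descends to the quotient (`IsCayleyDual.quotient`), with `D i` replaced by its part in
the annihilator: if a form killing `Δ^J` is a nonnegative combination of forms that are nonnegative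
on `Δ^J`, every form of positive weight kills `Δ^J` too. For `i ∉ J` this part is a face of `D i`,
hence a lattice polytope; for `j ∈ J` it is `{0}`. With the origin interior to the projected sum,
`IsCayleyDual.areDualNefPartitions` then gives the dual nef-partitions. The hull of the parts is the
intersection of `D_I` with the annihilator; it is a face with the origin in its relative interior,
hence the smallest face containing it. -/

namespace NefPartition

/-! ### Interior points in the canonical topology -/

section Interior

variable {V W : Type*} [AddCommGroup V] [Module ℝ V] [AddCommGroup W] [Module ℝ W]

/-- Surjective linear maps are open for the module topologies. -/
lemma image_mem_interior {P : Set V} (p : V →ₗ[ℝ] W) (hp : Function.Surjective p)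
    (h : (0 : V) ∈ @interior V (moduleTopology ℝ V) P) :
    (0 : W) ∈ @interior W (moduleTopology ℝ W) (p '' P) := by
  let := moduleTopology ℝ V
  let := moduleTopology ℝ W
  have : IsModuleTopology ℝ V := ⟨rfl⟩
  have : IsModuleTopology ℝ W := ⟨rfl⟩
  have : ContinuousAdd V := IsModuleTopology.toContinuousAdd ℝ V
  have : ContinuousAdd W := IsModuleTopology.toContinuousAdd ℝ W
  have : ContinuousSMul ℝ V := IsModuleTopology.toContinuousSMul ℝ V
  have : ContinuousSMul ℝ W := IsModuleTopology.toContinuousSMul ℝ W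
  have ho : IsOpenMap p := IsModuleTopology.isOpenMap_of_surjective hp
  have := ho.image_interior_subset P ⟨0, h, rfl⟩
  simpa using this

lemma exists_pos_smul_mem {P : Set V} (h : (0 : V) ∈ @interior V (moduleTopology ℝ V) P) (x : V) :
    ∃ ε : ℝ, 0 < ε ∧ ε • x ∈ P := by
  let := moduleTopology ℝ V
  have : IsModuleTopology ℝ V := ⟨rfl⟩
  have : ContinuousSMul ℝ V := IsModuleTopology.toContinuousSMul ℝ V
  have hc : Filter.Tendsto (fun t : ℝ => t • x) (nhds 0) (nhds 0) := by
    have : Continuous (fun t : ℝ => t • x) := by fun_prop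
    simpa using this.tendsto 0
  have h1 : ∀ᶠ t : ℝ in nhdsWithin 0 (Set.Ioi 0), t • x ∈ P :=
    (hc.eventually (mem_interior_iff_mem_nhds.1 h)).filter_mono nhdsWithin_le_nhds
  obtain ⟨t, ht, ht0⟩ := (h1.and self_mem_nhdsWithin).exists
  exact ⟨t, ht0, ht⟩

/-- The finitely many strict inequalities at the points of `S` cut out an open neighbourhood of the
origin. -/
lemma zero_mem_interior_dualPolytope (S : Finset V) :
    (0 : Module.Dual ℝ V) ∈ @interior _ (moduleTopology ℝ (Module.Dual ℝ V))
      (dualPolytope (convexHull ℝ (S : Set V))) := by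
  let := moduleTopology ℝ (Module.Dual ℝ V)
  have : IsModuleTopology ℝ (Module.Dual ℝ V) := ⟨rfl⟩
  have hopen : IsOpen (⋂ x ∈ S, {y : Module.Dual ℝ V | -1 < y x}) := by
    refine isOpen_biInter_finset fun x _ => ?_
    have : Continuous (Module.Dual.eval ℝ V x) := IsModuleTopology.continuous_of_linearMap _
    exact isOpen_lt continuous_const this
  refine mem_interior.2 ⟨_, fun y hy => ?_, hopen, by simp⟩
  simp only [Set.mem_iInter, Set.mem_ofPred_eq] at hy
  intro x hx
  have hconv : Convex ℝ {x : V | -1 ≤ y x} := convex_halfSpace_ge y.isLinear _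
  exact convexHull_min (fun s hs => (hy s hs).le) hconv hx

lemma span_eq_top_of_zero_mem_interior {S : Set V}
    (h : (0 : V) ∈ @interior V (moduleTopology ℝ V) (convexHull ℝ S)) :
    Submodule.span ℝ S = ⊤ := by
  rw [eq_top_iff]
  intro x _
  obtain ⟨ε, hε, hx⟩ := exists_pos_smul_mem h x
  have := convexHull_min Submodule.subset_span (Submodule.span ℝ S).convex hx
  exact (Submodule.smul_mem_iff _ hε.ne').1 this

end Interior

/-! ### Lattice polytopes, their faces and the bipolar theorem -/

section Polytopes

variable {V W : Type*} [AddCommGroup V] [Module ℝ V] [AddCommGroup W] [Module ℝ W]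

lemma IsLatticePolytope.convex {L : Submodule ℤ V} {P : Set V} (h : IsLatticePolytope L P) :
    Convex ℝ P := by
  obtain ⟨S, -, -, rfl⟩ := h
  exact convex_convexHull _ _

lemma IsLatticePolytope.exists_min {L : Submodule ℤ V} {P : Set V} (h : IsLatticePolytope L P)
    (l : Module.Dual ℝ V) : ∃ x ∈ P, ∀ z ∈ P, l x ≤ l z := by
  obtain ⟨S, hS, -, rfl⟩ := h
  obtain ⟨x, hx, hmin⟩ := S.exists_min_image l hS
  refine ⟨x, subset_convexHull _ _ hx, fun z hz => ?_⟩
  exact convexHull_min (t := {z | l x ≤ l z}) hmin (convex_halfSpace_ge l.isLinear _) hz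

lemma IsLatticePolytope.image {L : Submodule ℤ V} {L' : Submodule ℤ W} {P : Set V}
    (h : IsLatticePolytope L P) (p : V →ₗ[ℝ] W) (hp : ∀ x ∈ L, p x ∈ L') :
    IsLatticePolytope L' (p '' P) := by
  classical
  obtain ⟨S, hS, hL, rfl⟩ := h
  refine ⟨S.image p, hS.image _, ?_, ?_⟩
  · simp only [Finset.mem_image]
    rintro _ ⟨x, hx, rfl⟩
    exact hp x (hL x hx)
  · rw [p.image_convexHull, Finset.coe_image]

lemma isLatticePolytope_singleton_zero (L : Submodule ℤ V) : IsLatticePolytope L {0} :=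
  ⟨{0}, by simp, by simp, by simp⟩

lemma IsLatticePolytope.add {L : Submodule ℤ V} {P Q : Set V} (hP : IsLatticePolytope L P)
    (hQ : IsLatticePolytope L Q) : IsLatticePolytope L (P + Q) := by
  classical
  obtain ⟨S, hS, hSL, rfl⟩ := hP
  obtain ⟨T, hT, hTL, rfl⟩ := hQ
  refine ⟨S + T, hS.add hT, ?_, by rw [Finset.coe_add, convexHull_add]⟩
  intro x hx
  obtain ⟨s, hs, t, ht, rfl⟩ := Finset.mem_add.1 hx
  exact L.add_mem (hSL s hs) (hTL t ht)

lemma IsLatticePolytope.sum {L : Submodule ℤ V} {ι : Type*} (s : Finset ι) {P : ι → Set V}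
    (hP : ∀ i ∈ s, IsLatticePolytope L (P i)) : IsLatticePolytope L (∑ i ∈ s, P i) := by
  classical
  induction s using Finset.induction_on with
  | empty => exact isLatticePolytope_singleton_zero L
  | insert a s ha ih =>
    rw [Finset.sum_insert ha]
    exact (hP a (by simp)).add (ih fun i hi => hP i (by simp [hi]))

lemma IsLatticePolytope.convexHull_iUnion {L : Submodule ℤ V} {ι : Type*} [Fintype ι] [Nonempty ι]
    {P : ι → Set V} (hP : ∀ i, IsLatticePolytope L (P i)) :
    IsLatticePolytope L (convexHull ℝ (⋃ i, P i)) := by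
  classical
  choose S hS hSL hSP using hP
  refine ⟨Finset.univ.biUnion S, ?_, ?_, ?_⟩
  · obtain ⟨i⟩ := ‹Nonempty ι›
    obtain ⟨x, hx⟩ := hS i
    exact ⟨x, by simpa using ⟨i, hx⟩⟩
  · intro x hx
    obtain ⟨i, -, hi⟩ := Finset.mem_biUnion.1 hx
    exact hSL i x hi
  · apply subset_antisymm
    · refine convexHull_min (Set.iUnion_subset fun i => ?_) (convex_convexHull _ _)
      rw [hSP i]
      exact convexHull_mono fun x hx => by simpa using ⟨i, hx⟩
    · refine convexHull_mono fun x hx => ?_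
      simp only [Finset.coe_biUnion, Set.mem_iUnion] at hx ⊢
      obtain ⟨i, -, hi⟩ := hx
      exact ⟨i, by rw [hSP i]; exact subset_convexHull _ _ hi⟩

/-- A face of a lattice polytope cut out by a supporting hyperplane through the origin is the convex
hull of the vertices that it contains. -/
lemma convexHull_inter_ker (S : Finset V) (l : Module.Dual ℝ V) (hl : ∀ s ∈ S, 0 ≤ l s) :
    {x ∈ convexHull ℝ (S : Set V) | l x = 0} =
      convexHull ℝ ((S.filter fun s => l s = 0 : Finset V) : Set V) := by
  apply subset_antisymm
  · rintro x ⟨hx, hlx⟩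
    obtain ⟨w, hw0, hw1, rfl⟩ := Finset.mem_convexHull'.1 hx
    simp only [map_sum, map_smul, smul_eq_mul] at hlx
    have hz := (Finset.sum_eq_zero_iff_of_nonneg
      fun s hs => mul_nonneg (hw0 s hs) (hl s hs)).1 hlx
    have hw : ∀ s ∈ S, l s ≠ 0 → w s = 0 := fun s hs h =>
      (mul_eq_zero.1 (hz s hs)).resolve_right h
    refine Finset.mem_convexHull'.2 ⟨w, fun s hs => hw0 s (Finset.mem_filter.1 hs).1, ?_, ?_⟩
    · rw [← hw1]
      exact Finset.sum_filter_of_ne fun s hs h => by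
        by_contra h'
        exact h (hw s hs h')
    · exact Finset.sum_filter_of_ne fun s hs h => by
        by_contra h'
        exact h (by rw [hw s hs h', zero_smul])
  · intro x hx
    refine ⟨convexHull_mono (Finset.coe_subset.2 (Finset.filter_subset _ _)) hx, ?_⟩
    exact convexHull_min (t := {x | l x = 0}) (fun s hs => by simpa using (Finset.mem_filter.1 hs).2)
      (convex_hyperplane l.isLinear _) hx

/-- The intersection of a lattice polytope with a supporting hyperplane through the origin is a
lattice polytope if it contains the origin. -/
lemma IsLatticePolytope.inter_ker {L : Submodule ℤ V} {P : Set V} (h : IsLatticePolytope L P)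
    (h0 : (0 : V) ∈ P) (l : Module.Dual ℝ V) (hl : ∀ x ∈ P, 0 ≤ l x) :
    IsLatticePolytope L {x ∈ P | l x = 0} := by
  obtain ⟨S, hS, hL, rfl⟩ := h
  have key := convexHull_inter_ker S l fun s hs => hl s (subset_convexHull _ _ hs)
  refine ⟨S.filter fun s => l s = 0, ?_, fun x hx => hL x (Finset.mem_filter.1 hx).1, key⟩
  rw [← Finset.coe_nonempty, ← convexHull_nonempty_iff (𝕜 := ℝ), ← key]
  exact ⟨0, h0, map_zero l⟩

/-- Carries a polytope lying in an annihilator over to the dual of the quotient. -/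
lemma IsLatticePolytope.preimage {L : Submodule ℤ V} {L' : Submodule ℤ W} {P : Set W}
    (h : IsLatticePolytope L' P) (f : V →ₗ[ℝ] W) (hf : Function.Injective f)
    (hP : P ⊆ Set.range f) (hL : ∀ x, f x ∈ L' → x ∈ L) : IsLatticePolytope L (f ⁻¹' P) := by
  classical
  obtain ⟨S, hS, hSL, rfl⟩ := h
  have hSr : (S : Set W) ⊆ Set.range f := (subset_convexHull ℝ _).trans hP
  have himg : (S.preimage f hf.injOn).image f = S := by
    rw [Finset.image_preimage, Finset.filter_true_of_mem fun x hx => hSr hx]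
  refine ⟨S.preimage f hf.injOn, ?_, ?_, ?_⟩
  · rw [← himg] at hS
    exact Finset.image_nonempty.1 hS
  · intro x hx
    exact hL x (hSL _ (Finset.mem_preimage.1 hx))
  · conv_lhs => rw [← himg, Finset.coe_image, ← f.image_convexHull]
    exact Set.preimage_image_eq _ hf

/-- A point outside a polytope can be separated from it strictly. -/
lemma exists_dual_lt [FiniteDimensional ℝ V] (S : Finset V) {x : V}
    (hx : x ∉ convexHull ℝ (S : Set V)) :
    ∃ (l : Module.Dual ℝ V) (u : ℝ), l x < u ∧ ∀ z ∈ convexHull ℝ (S : Set V), u < l z := by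
  -- `V` carries no topology, so Hahn–Banach is applied in coordinates.
  let e := (Module.finBasis ℝ V).equivFun
  have hc : IsClosed (e '' convexHull ℝ (S : Set V)) := by
    have : e '' convexHull ℝ (S : Set V) = convexHull ℝ (e '' S) :=
      e.toLinearMap.image_convexHull _
    rw [this]
    exact (S.finite_toSet.image e).isClosed_convexHull ℝ
  have hconv : Convex ℝ (e '' convexHull ℝ (S : Set V)) :=
    (convex_convexHull ℝ _).linear_image e.toLinearMap
  obtain ⟨f, u, h1, h2⟩ := geometric_hahn_banach_point_closed hconv hc
    (x := e x) (by simpa using hx)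
  exact ⟨f.toLinearMap ∘ₗ e.toLinearMap, u, h1, fun z hz => h2 _ ⟨z, hz, rfl⟩⟩

/-- The bipolar theorem for polytopes. -/
lemma dualPolytope_dualPolytope [FiniteDimensional ℝ V] (S : Finset V)
    (h0 : (0 : V) ∈ convexHull ℝ (S : Set V)) :
    dualPolytope (dualPolytope (convexHull ℝ (S : Set V))) =
      Module.Dual.eval ℝ V '' convexHull ℝ (S : Set V) := by
  apply subset_antisymm
  · intro φ hφ
    obtain ⟨x, rfl⟩ := (Module.evalEquiv ℝ V).surjective φ
    refine ⟨x, ?_, rfl⟩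
    by_contra hx
    obtain ⟨l, u, h1, h2⟩ := exists_dual_lt S hx
    have hu : u < 0 := by simpa using h2 0 h0
    -- Since `u < 0`, rescaling by `-u` moves the separating level to `-1`.
    have hmem : (-u)⁻¹ • l ∈ dualPolytope (convexHull ℝ (S : Set V)) := by
      intro z hz
      have := h2 z hz
      have hu' : 0 < -u := by linarith
      simp only [LinearMap.smul_apply, smul_eq_mul]
      rw [inv_mul_eq_div, le_div_iff₀ hu']
      linarith
    have : -1 ≤ (-u)⁻¹ * l x := hφ _ hmem
    have hu' : 0 < -u := by linarith
    rw [inv_mul_eq_div, le_div_iff₀ hu'] at this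
    linarith
  · rintro _ ⟨x, hx, rfl⟩ y hy
    exact hy x hx

end Polytopes

/-! ### Dual lattices and a criterion for being a lattice -/

section Lattices

variable {V W : Type*} [AddCommGroup V] [Module ℝ V] [AddCommGroup W] [Module ℝ W]

lemma mem_dualLattice {L : Submodule ℤ V} {y : Module.Dual ℝ V} :
    y ∈ dualLattice L ↔ ∀ x ∈ L, ∃ n : ℤ, y x = n := Iff.rfl

lemma eval_mem_dualLattice (L : Submodule ℤ V) {x : V} (hx : x ∈ L) :
    Module.Dual.eval ℝ V x ∈ dualLattice (dualLattice L) :=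
  fun _ hy => hy x hx

lemma dualMap_mem_dualLattice_iff {L : Submodule ℤ V} (p : V →ₗ[ℝ] W) (z : Module.Dual ℝ W) :
    p.dualMap z ∈ dualLattice L ↔ z ∈ dualLattice (L.map (p.restrictScalars ℤ)) := by
  simp [mem_dualLattice]

lemma isLattice_dualLattice {L : Submodule ℤ V} (h : IsLattice L) :
    IsLattice (dualLattice L) := by
  classical
  obtain ⟨d, b, rfl⟩ := h
  refine ⟨d, b.dualBasis, le_antisymm ?_ ?_⟩
  · intro y hy
    have hsum : y = ∑ i, y (b i) • b.dualBasis i := by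
      refine b.ext fun j => ?_
      simp
    rw [hsum]
    refine Submodule.sum_mem _ fun i _ => ?_
    obtain ⟨n, hn⟩ := hy (b i) (Submodule.subset_span ⟨i, rfl⟩)
    rw [hn]
    have := Submodule.smul_mem _ n (Submodule.subset_span (R := ℤ) (s := Set.range b.dualBasis) ⟨i, rfl⟩)
    rwa [← Int.cast_smul_eq_zsmul ℝ] at this
  · rw [Submodule.span_le]
    rintro _ ⟨i, rfl⟩ x hx
    induction hx using Submodule.span_induction with
    | mem x hx =>
      obtain ⟨j, rfl⟩ := hx
      rw [Module.Basis.dualBasis_apply_self]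
      split_ifs
      · exact ⟨1, by simp⟩
      · exact ⟨0, by simp⟩
    | zero => exact ⟨0, by simp⟩
    | add x y _ _ hx hy =>
      obtain ⟨m, hm⟩ := hx
      obtain ⟨n, hn⟩ := hy
      exact ⟨m + n, by rw [map_add, hm, hn, Int.cast_add]⟩
    | smul c x _ hx =>
      obtain ⟨m, hm⟩ := hx
      exact ⟨c * m, by rw [map_zsmul, hm, zsmul_eq_mul, Int.cast_mul]⟩

/-- A subgroup that spans the space is a lattice if the linear forms with integral values on it span
the dual space. -/
lemma isLattice_of_span_dualLattice [FiniteDimensional ℝ V] {L : Submodule ℤ V}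
    (h : Submodule.span ℝ (L : Set V) = ⊤)
    (hd : Submodule.span ℝ (dualLattice L : Set (Module.Dual ℝ V)) = ⊤) : IsLattice L := by
  classical
  obtain ⟨b, hb⟩ : ∃ b : Module.Basis (Fin (Module.finrank ℝ (Module.Dual ℝ V))) ℝ
      (Module.Dual ℝ V), ∀ i, b i ∈ dualLattice L := by
    let c := Module.Basis.ofSpan hd.ge
    have : Fintype _ := FiniteDimensional.fintypeBasisIndex c
    let σ := Fintype.equivFinOfCardEq (Module.finrank_eq_card_basis c).symm
    refine ⟨c.reindex σ, fun i => ?_⟩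
    rw [Module.Basis.reindex_apply]
    exact Module.Basis.ofSpan_subset hd.ge ⟨_, rfl⟩
  -- The integral forms `b i` serve as coordinates: they send `L` into the standard integer lattice,
  -- so its image is discrete.
  let f : V →ₗ[ℝ] (Fin (Module.finrank ℝ (Module.Dual ℝ V)) → ℝ) := LinearMap.pi b
  have hf : Function.Injective f := by
    rw [injective_iff_map_eq_zero]
    intro x hx
    rw [← Module.forall_dual_apply_eq_zero_iff ℝ]
    intro y
    have : ∀ i, b i x = 0 := fun i => congrFun hx i
    rw [← b.sum_repr y, LinearMap.sum_apply]
    exact Finset.sum_eq_zero fun i _ => by rw [LinearMap.smul_apply, this, smul_zero]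
  let e := LinearEquiv.ofInjectiveOfFinrankEq f hf (by simp)
  have he : ∀ x i, e x i = b i x := fun x i => rfl
  let L' : Submodule ℤ (Fin (Module.finrank ℝ (Module.Dual ℝ V)) → ℝ) :=
    L.map (e.toLinearMap.restrictScalars ℤ)
  have hle : (L' : Set (Fin (Module.finrank ℝ (Module.Dual ℝ V)) → ℝ)) ⊆
      Submodule.span ℤ (Set.range (Pi.basisFun ℝ (Fin (Module.finrank ℝ (Module.Dual ℝ V))))) := by
    rintro _ ⟨x, hx, rfl⟩
    rw [SetLike.mem_coe, Module.Basis.mem_span_iff_repr_mem]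
    intro i
    obtain ⟨n, hn⟩ := hb i x hx
    exact ⟨n, by simp [he, hn]⟩
  have : DiscreteTopology L' := DiscreteTopology.of_subset (inferInstanceAs (DiscreteTopology
    (Submodule.span ℤ (Set.range (Pi.basisFun ℝ (Fin (Module.finrank ℝ (Module.Dual ℝ V)))))))) hle
  have : IsZLattice ℝ L' := ⟨by
    have : (L' : Set _) = e.toLinearMap '' L := rfl
    rw [this, Submodule.span_image, h, Submodule.map_top, LinearEquiv.range]⟩
  have : Module.Finite ℤ L' := ZLattice.module_finite ℝ L'
  have : Module.Free ℤ L' := ZLattice.module_free ℝ L'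
  let β := (Module.finBasis ℤ L').ofZLatticeBasis ℝ L'
  refine ⟨_, β.map e.symm, ?_⟩
  have hβ : Submodule.span ℤ (Set.range β) = L' := (Module.finBasis ℤ L').ofZLatticeBasis_span ℝ
  have hr : Set.range (β.map e.symm) =
      (e.symm.toLinearMap.restrictScalars ℤ) '' Set.range β := by
    rw [← Set.range_comp]; rfl
  rw [hr, Submodule.span_image, hβ, ← Submodule.map_comp]
  have : (e.symm.toLinearMap.restrictScalars ℤ) ∘ₗ (e.toLinearMap.restrictScalars ℤ) =
      LinearMap.id := by ext; simp
  rw [this, Submodule.map_id]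

end Lattices

end NefPartition

namespace NefPartition

/-! ### Duality of Cayley cones -/

section Cayley

variable {V : Type*} [AddCommGroup V] [Module ℝ V] {r : ℕ}

lemma isReflexive_dualPolytope [FiniteDimensional ℝ V] {L : Submodule ℤ V} {P : Set V}
    (hP : IsLatticePolytope L P) (h0 : (0 : V) ∈ P)
    (hd : IsLatticePolytope (dualLattice L) (dualPolytope P)) :
    IsReflexive (dualLattice L) (dualPolytope P) where
  isLatticePolytope := hd
  zero_mem_interior := by
    obtain ⟨S, -, -, rfl⟩ := hP
    exact zero_mem_interior_dualPolytope S
  dual_isLatticePolytope := by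
    have himg := hP.image (L' := dualLattice (dualLattice L)) (Module.Dual.eval ℝ V)
      fun x hx => eval_mem_dualLattice L hx
    obtain ⟨S, -, -, rfl⟩ := hP
    rwa [dualPolytope_dualPolytope S h0]

/-- The duality of the Cayley cones of `Δ` and `D`, spelled out in terms of linear inequalities on
the one side and weighted sums of points on the other. -/
def IsCayleyDual (Δ : Fin r → Set V) (D : Fin r → Set (Module.Dual ℝ V)) : Prop :=
  ∀ (y : Module.Dual ℝ V) (t : Fin r → ℝ), (∀ i, ∀ x ∈ Δ i, 0 ≤ y x + t i) ↔
    (∀ i, 0 ≤ t i) ∧ ∃ d : Fin r → Module.Dual ℝ V, (∀ i, d i ∈ D i) ∧ y = ∑ i, t i • d i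

lemma mem_dual_cayleyCone {Δ : Fin r → Set V} {w : Module.Dual ℝ V × (Fin r → ℝ)} :
    w ∈ PointedCone.dual (cayleyPairing V r) (cayleyCone Δ) ↔
      ∀ i, ∀ x ∈ Δ i, 0 ≤ w.1 x + w.2 i := by
  have hpair : ∀ z, cayleyPairing V r z w = w.1 z.1 + ∑ i, z.2 i * w.2 i := fun z => rfl
  rw [cayleyCone, PointedCone.dual_hull, PointedCone.mem_dual]
  constructor
  · intro h i x hx
    have hmem : (x, (Pi.single i 1 : Fin r → ℝ)) ∈ cayleyPolytope Δ :=
      subset_convexHull _ _ (Set.mem_iUnion.2 ⟨i, hx, rfl⟩)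
    have := h hmem
    rw [hpair] at this
    simpa [Pi.single_apply] using this
  · intro h z hz
    have hconv : Convex ℝ {z | 0 ≤ (cayleyPairing V r).flip w z} :=
      convex_halfSpace_ge ((cayleyPairing V r).flip w).isLinear _
    refine convexHull_min (Set.iUnion_subset fun i => ?_) hconv hz
    rintro ⟨x, s⟩ ⟨hx, rfl⟩
    change 0 ≤ cayleyPairing V r _ w
    rw [hpair]
    simpa [Pi.single_apply] using h i x hx

lemma mem_cayleyCone {D : Fin r → Set V} (hconv : ∀ i, Convex ℝ (D i)) (h0 : ∀ i, (0 : V) ∈ D i)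
    {w : V × (Fin r → ℝ)} :
    w ∈ cayleyCone D ↔
      (∀ i, 0 ≤ w.2 i) ∧ ∃ d : Fin r → V, (∀ i, d i ∈ D i) ∧ w.1 = ∑ i, w.2 i • d i := by
  constructor
  · intro hw
    -- With dilates `w.2 i • D i` in place of weighted points, closure under addition is the
    -- identity `(s + t) • D i = s • D i + t • D i` for convex `D i`, and weight zero needs no
    -- separate case.
    let C : PointedCone ℝ (V × (Fin r → ℝ)) :=
      { carrier := {w | (∀ i, 0 ≤ w.2 i) ∧
          ∃ d : Fin r → V, (∀ i, d i ∈ w.2 i • D i) ∧ w.1 = ∑ i, d i}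
        zero_mem' := ⟨fun i => le_rfl, 0, fun i => ⟨0, h0 i, by simp⟩, by simp⟩
        add_mem' := by
          rintro u v ⟨hu, d, hd, hud⟩ ⟨hv, e, he, hve⟩
          refine ⟨fun i => add_nonneg (hu i) (hv i), d + e, fun i => ?_, ?_⟩
          · rw [Prod.snd_add, Pi.add_apply, (hconv i).add_smul (hu i) (hv i)]
            exact Set.add_mem_add (hd i) (he i)
          · simp [hud, hve, Finset.sum_add_distrib]
        smul_mem' := by
          rintro ⟨c, hc⟩ u ⟨hu, d, hd, hud⟩
          refine ⟨fun i => mul_nonneg hc (hu i), fun i => c • d i, fun i => ?_, ?_⟩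
          · obtain ⟨x, hx, hxd⟩ := hd i
            exact ⟨x, hx, by simp only [← hxd]; exact mul_smul c _ _⟩
          · rw [← Finset.smul_sum, ← hud]
            rfl }
    have hle : cayleyCone D ≤ C := by
      refine Submodule.span_le.2 (convexHull_min (Set.iUnion_subset fun i => ?_) C.convex)
      rintro ⟨x, s⟩ ⟨hx, rfl⟩
      refine ⟨fun k => ?_, fun k => if k = i then x else 0, fun k => ?_, by simp⟩
      · by_cases hk : k = i <;> simp [hk]
      · by_cases hk : k = i
        · subst hk
          simpa using hx
        · simpa [hk] using ⟨0, h0 k, by simp⟩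
    obtain ⟨hw0, d, hd, hwd⟩ := hle hw
    choose e he hed using hd
    exact ⟨hw0, e, he, by simp only [hwd, ← hed]⟩
  · rintro ⟨hw0, d, hd, hwd⟩
    have hw : w = ∑ i, (⟨w.2 i, hw0 i⟩ : {c : ℝ // 0 ≤ c}) • (d i, (Pi.single i 1 : Fin r → ℝ)) := by
      ext k
      · simpa [Prod.fst_sum] using hwd
      · simp [Prod.snd_sum, Finset.sum_apply, Pi.single_apply, Nonneg.mk_smul]
    rw [hw]
    refine Submodule.sum_mem _ fun i _ => Submodule.smul_mem _ _ ?_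
    exact PointedCone.subset_hull (subset_convexHull _ _ (Set.mem_iUnion.2 ⟨i, hd i, rfl⟩))

lemma dual_cayleyCone_eq_iff {Δ : Fin r → Set V} {D : Fin r → Set (Module.Dual ℝ V)}
    (hconv : ∀ i, Convex ℝ (D i)) (h0 : ∀ i, (0 : Module.Dual ℝ V) ∈ D i) :
    PointedCone.dual (cayleyPairing V r) (cayleyCone Δ) = cayleyCone D ↔ IsCayleyDual Δ D := by
  rw [SetLike.ext_iff, Prod.forall]
  simp only [mem_dual_cayleyCone, mem_cayleyCone hconv h0]
  rfl

namespace IsCayleyDual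

variable {Δ : Fin r → Set V} {D : Fin r → Set (Module.Dual ℝ V)}

/-- This is the duality at `t = eᵢ`; the origin fills the slots of weight zero. -/
lemma mem_iff (h : IsCayleyDual Δ D) (h0 : ∀ i, (0 : Module.Dual ℝ V) ∈ D i) {i : Fin r}
    {y : Module.Dual ℝ V} :
    y ∈ D i ↔ ∀ k, ∀ x ∈ Δ k, 0 ≤ y x + (Pi.single i 1 : Fin r → ℝ) k := by
  rw [h y (Pi.single i 1)]
  constructor
  · intro hy
    refine ⟨fun k => ?_, fun k => if k = i then y else 0, fun k => ?_, by simp⟩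
    · by_cases hk : k = i <;> simp [hk]
    · by_cases hk : k = i
      · subst hk
        simpa using hy
      · simpa [hk] using h0 k
  · rintro ⟨-, d, hd, rfl⟩
    simpa [Pi.single_apply] using hd i

lemma neg_one_le (h : IsCayleyDual Δ D) (h0 : ∀ i, (0 : Module.Dual ℝ V) ∈ D i) {i : Fin r}
    {y : Module.Dual ℝ V} (hy : y ∈ D i) {x : V} (hx : x ∈ Δ i) : -1 ≤ y x := by
  have := (h.mem_iff h0).1 hy i x hx
  simp only [Pi.single_eq_same] at this
  linarith

lemma nonneg (h : IsCayleyDual Δ D) (h0 : ∀ i, (0 : Module.Dual ℝ V) ∈ D i) {i k : Fin r}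
    (hik : k ≠ i) {y : Module.Dual ℝ V} (hy : y ∈ D i) {x : V} (hx : x ∈ Δ k) : 0 ≤ y x := by
  simpa [hik] using (h.mem_iff h0).1 hy k x hx

/-- This is the duality at `t = (1, …, 1)`. -/
lemma sum_eq_dualPolytope (h : IsCayleyDual Δ D) :
    ∑ i, D i = dualPolytope (convexHull ℝ (⋃ i, Δ i)) := by
  ext y
  have h1 := h y 1
  have h2 : (∀ i, ∀ x ∈ Δ i, 0 ≤ y x + (1 : Fin r → ℝ) i) ↔
      y ∈ dualPolytope (convexHull ℝ (⋃ i, Δ i)) := by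
    constructor
    · intro hy x hx
      refine convexHull_min (t := {x | -1 ≤ y x}) (Set.iUnion_subset fun i x hx => ?_)
        (convex_halfSpace_ge y.isLinear _) hx
      have := hy i x hx
      simp only [Pi.one_apply] at this
      change -1 ≤ y x
      linarith
    · intro hy i x hx
      have := hy x (subset_convexHull _ _ (Set.mem_iUnion.2 ⟨i, hx⟩))
      simp only [Pi.one_apply]
      linarith
  rw [← h2, h1, Set.mem_finsetSum]
  constructor
  · rintro ⟨g, hg, rfl⟩
    exact ⟨by simp, g, fun i => hg (Finset.mem_univ i), by simp⟩
  · rintro ⟨-, d, hd, rfl⟩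
    exact ⟨d, fun {i} _ => hd i, by simp⟩

lemma dualPolytope_sum [Nonempty (Fin r)] (h : IsCayleyDual Δ D) {L : Submodule ℤ V}
    (hΔ : ∀ i, IsLatticePolytope L (Δ i)) (h0 : ∀ i, (0 : Module.Dual ℝ V) ∈ D i) :
    dualPolytope (∑ i, Δ i) = convexHull ℝ (⋃ i, D i) := by
  apply subset_antisymm
  · intro y hy
    obtain ⟨i₀⟩ := ‹Nonempty (Fin r)›
    choose x hx hmin using fun i => (hΔ i).exists_min y
    have hsum : -1 ≤ ∑ i, y (x i) := by
      rw [← map_sum]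
      exact hy _ (Set.finsetSum_mem_finsetSum _ _ _ fun i _ => hx i)
    -- The least admissible weights are minus the minima of `y`, with total at most `1`. The deficit
    -- is added at `i₀`, so that the weights sum to `1` and give a convex combination.
    let t : Fin r → ℝ := (fun i => -y (x i)) + Pi.single i₀ (1 + ∑ i, y (x i))
    have ht : ∀ i, ∀ z ∈ Δ i, 0 ≤ y z + t i := by
      intro i z hz
      have h1 := hmin i z hz
      have h2 : 0 ≤ (Pi.single i₀ (1 + ∑ i, y (x i)) : Fin r → ℝ) i := by
        by_cases hi : i = i₀
        · subst hi
          simpa using (by linarith : 0 ≤ 1 + ∑ i, y (x i))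
        · simp [hi]
      simp only [t, Pi.add_apply]
      linarith
    have ht1 : ∑ i, t i = 1 := by
      simp [t, Finset.sum_add_distrib]
    obtain ⟨htn, d, hd, hyd⟩ := (h y t).1 ht
    rw [hyd]
    exact (convex_convexHull ℝ _).sum_mem (fun i _ => htn i) ht1
      fun i _ => subset_convexHull _ _ (Set.mem_iUnion.2 ⟨i, hd i⟩)
  · intro y hy x hx
    refine convexHull_min (t := {y : Module.Dual ℝ V | -1 ≤ Module.Dual.eval ℝ V x y})
      (Set.iUnion_subset fun i y hy => ?_)
      (convex_halfSpace_ge (Module.Dual.eval ℝ V x).isLinear _) hy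
    obtain ⟨g, hg, rfl⟩ := (Set.mem_finsetSum _ _ _).1 hx
    change -1 ≤ y (∑ i, g i)
    rw [map_sum, ← Finset.add_sum_erase _ _ (Finset.mem_univ i)]
    have h1 := h.neg_one_le h0 hy (hg (Finset.mem_univ i))
    have h2 : 0 ≤ ∑ k ∈ Finset.univ.erase i, y (g k) := Finset.sum_nonneg fun k hk =>
      h.nonneg h0 (Finset.ne_of_mem_erase hk) hy (hg (Finset.mem_univ k))
    linarith

/-- The sum is the dual of the hull of the `Δ i`, and that hull is a lattice polytope containing the
origin. `L` itself need not be known to be a lattice. -/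
lemma isReflexive_sum_right [FiniteDimensional ℝ V] [Nonempty (Fin r)] (h : IsCayleyDual Δ D)
    {L : Submodule ℤ V} (hΔ : ∀ i, IsLatticePolytope L (Δ i)) (hΔ0 : ∀ i, (0 : V) ∈ Δ i)
    (hD : ∀ i, IsLatticePolytope (dualLattice L) (D i)) :
    IsReflexive (dualLattice L) (∑ i, D i) := by
  obtain ⟨i⟩ := ‹Nonempty (Fin r)›
  have hsum := IsLatticePolytope.sum Finset.univ fun i _ => hD i
  rw [h.sum_eq_dualPolytope] at hsum ⊢
  have : Nonempty (Fin r) := ⟨i⟩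
  exact isReflexive_dualPolytope (IsLatticePolytope.convexHull_iUnion hΔ)
    (subset_convexHull _ _ (Set.mem_iUnion.2 ⟨i, hΔ0 i⟩)) hsum

/-- Families of lattice polytopes with dual Cayley cones are dual nef-partitions as soon as the
Minkowski sum of the first family has the origin in its interior. -/
lemma areDualNefPartitions [FiniteDimensional ℝ V] [Nonempty (Fin r)] (h : IsCayleyDual Δ D)
    {L : Submodule ℤ V} (hL : IsLattice L) (hΔ : ∀ i, IsLatticePolytope L (Δ i))
    (hΔ0 : ∀ i, (0 : V) ∈ Δ i) (hD : ∀ i, IsLatticePolytope (dualLattice L) (D i))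
    (h0 : ∀ i, (0 : Module.Dual ℝ V) ∈ D i)
    (hint : (0 : V) ∈ @interior V (moduleTopology ℝ V) (∑ i, Δ i)) :
    AreDualNefPartitions L Δ D where
  left :=
    { isLattice := hL
      isLatticePolytope := hΔ
      zero_mem := hΔ0
      isReflexive_sum :=
        { isLatticePolytope := IsLatticePolytope.sum _ fun i _ => hΔ i
          zero_mem_interior := hint
          dual_isLatticePolytope := by
            rw [h.dualPolytope_sum hΔ h0]
            exact IsLatticePolytope.convexHull_iUnion hD } }
  right :=
    { isLattice := isLattice_dualLattice hL
      isLatticePolytope := hD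
      zero_mem := h0
      isReflexive_sum := h.isReflexive_sum_right hΔ hΔ0 hD }
  dual_cayleyCone := (dual_cayleyCone_eq_iff (fun i => (hD i).convex) h0).2 h

/-- Cayley duality descends to the quotient by the span of some of the polytopes. -/
lemma quotient {W : Type*} [AddCommGroup W] [Module ℝ W] (h : IsCayleyDual Δ D)
    (hΔ0 : ∀ i, (0 : V) ∈ Δ i) (h0 : ∀ i, (0 : Module.Dual ℝ V) ∈ D i) (J : Finset (Fin r))
    (p : V →ₗ[ℝ] W) (hp : Function.Surjective p) (hpJ : ∀ j ∈ J, ∀ x ∈ Δ j, p x = 0)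
    (hrange : ∀ y : Module.Dual ℝ V, (∀ j ∈ J, ∀ x ∈ Δ j, y x = 0) → y ∈ Set.range p.dualMap) :
    IsCayleyDual (fun i => p '' Δ i) (fun i => p.dualMap ⁻¹' D i) := by
  classical
  intro z t
  constructor
  · intro hz
    have ht : ∀ i, 0 ≤ t i := fun i => by simpa using hz i _ ⟨0, hΔ0 i, rfl⟩
    refine ⟨ht, ?_⟩
    -- For `i ∈ J` the form already vanishes on `Δ i`, so its weight can be dropped. Only forms from
    -- `D i` with `i ∉ J`, nonnegative on `Δ^J`, then contribute.
    let t' : Fin r → ℝ := fun i => if i ∈ J then 0 else t i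
    have hz' : ∀ i, ∀ x ∈ Δ i, 0 ≤ p.dualMap z x + t' i := by
      intro i x hx
      by_cases hi : i ∈ J
      · simp [t', hi, hpJ i hi x hx]
      · simpa [t', hi] using hz i _ ⟨x, hx, rfl⟩
    obtain ⟨ht', d, hd, hzd⟩ := (h (p.dualMap z) t').1 hz'
    have hvan : ∀ i, t' i ≠ 0 → d i ∈ Set.range p.dualMap := by
      intro i hi
      refine hrange _ fun j hj x hx => ?_
      have hsum : ∑ k, t' k * d k x = 0 := by
        have := LinearMap.congr_fun hzd x
        simp only [LinearMap.dualMap_apply, hpJ j hj x hx, map_zero, LinearMap.sum_apply,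
          LinearMap.smul_apply, smul_eq_mul] at this
        exact this.symm
      have hnn : ∀ k ∈ Finset.univ, 0 ≤ t' k * d k x := by
        intro k _
        by_cases hk : k ∈ J
        · simp [t', hk]
        · exact mul_nonneg (ht' k) (h.nonneg h0 (ne_of_mem_of_not_mem hj hk) (hd k) hx)
      exact (mul_eq_zero.1 ((Finset.sum_eq_zero_iff_of_nonneg hnn).1 hsum i
        (Finset.mem_univ i))).resolve_left hi
    -- Where `t' i = 0`, taking `e = 0` makes the original weight `t i` harmless; elsewhere the two
    -- weights agree.
    have he : ∀ i, ∃ e : Module.Dual ℝ W, p.dualMap e ∈ D i ∧ t i • e = t' i • e ∧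
        t' i • p.dualMap e = t' i • d i := by
      intro i
      by_cases hi : t' i = 0
      · exact ⟨0, by simpa using h0 i, by simp, by simp [hi]⟩
      · obtain ⟨e, he⟩ := hvan i hi
        refine ⟨e, he ▸ hd i, ?_, by rw [he]⟩
        have : t' i = t i := by
          by_cases hJ : i ∈ J
          · exact absurd (if_pos hJ) hi
          · exact if_neg hJ
        rw [this]
    choose e heD het hed using he
    refine ⟨e, heD, LinearMap.dualMap_injective_of_surjective hp ?_⟩
    rw [hzd, map_sum]
    exact Finset.sum_congr rfl fun i _ => by rw [het, map_smul, hed]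
  · rintro ⟨ht, e, he, rfl⟩ i _ ⟨x, hx, rfl⟩
    have := (h (p.dualMap (∑ i, t i • e i)) t).2
      ⟨ht, fun i => p.dualMap (e i), he, by simp [map_sum]⟩ i x hx
    exact this

end IsCayleyDual

end Cayley

end NefPartition

/-! ### Faces through the origin and the projected lattice -/

namespace NefPartition

variable {V : Type*} [AddCommGroup V] [Module ℝ V] {r : ℕ}

/-- A nonnegative linear form on a polytope vanishes on it as soon as it vanishes at a suitable
point. -/
lemma IsLatticePolytope.exists_test_point {L : Submodule ℤ V} {P : Set V}
    (h : IsLatticePolytope L P) : ∃ x₀ ∈ Submodule.span ℝ P, ∀ y : Module.Dual ℝ V,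
      (∀ x ∈ P, 0 ≤ y x) → 0 ≤ y x₀ ∧ (y x₀ = 0 → ∀ x ∈ P, y x = 0) := by
  obtain ⟨S, -, -, rfl⟩ := h
  have hS := subset_convexHull ℝ (S : Set V)
  refine ⟨∑ s ∈ S, s, Submodule.sum_mem _ fun s hs => Submodule.subset_span (hS hs),
    fun y hy => ?_⟩
  rw [map_sum]
  have hnn : ∀ s ∈ S, 0 ≤ y s := fun s hs => hy s (hS hs)
  refine ⟨Finset.sum_nonneg hnn, fun h0 x hx => ?_⟩
  exact convexHull_min (t := {x | y x = 0}) ((Finset.sum_eq_zero_iff_of_nonneg hnn).1 h0)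
    (convex_hyperplane y.isLinear _) hx

/-- For forms nonnegative on the `Δ j`, killing `Δ^J` becomes a single linear equation, so the
annihilator acts as a supporting hyperplane. -/
lemma exists_test_point {L : Submodule ℤ V} {Δ : Fin r → Set V}
    (h : ∀ i, IsLatticePolytope L (Δ i)) (J : Finset (Fin r)) :
    ∃ x₀ : V, ∀ y : Module.Dual ℝ V, (∀ j ∈ J, ∀ x ∈ Δ j, 0 ≤ y x) →
      0 ≤ y x₀ ∧ (y x₀ = 0 ↔ ∀ j ∈ J, ∀ x ∈ Δ j, y x = 0) := by
  choose x hx hy using fun i => (h i).exists_test_point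
  refine ⟨∑ j ∈ J, x j, fun y hnn => ?_⟩
  rw [map_sum]
  have hnn' : ∀ j ∈ J, 0 ≤ y (x j) := fun j hj => (hy j y (hnn j hj)).1
  refine ⟨Finset.sum_nonneg hnn', ?_⟩
  rw [Finset.sum_eq_zero_iff_of_nonneg hnn']
  refine forall₂_congr fun j hj => ⟨(hy j y (hnn j hj)).2, fun h0 => ?_⟩
  exact (Submodule.span_le (p := LinearMap.ker y)).2 h0 (hx j)

lemma subset_linSum {Δ : Fin r → Set V} (h0 : ∀ i, (0 : V) ∈ Δ i) {J : Finset (Fin r)} {j : Fin r}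
    (hj : j ∈ J) : Δ j ⊆ linSum Δ J := by
  intro x hx
  refine Submodule.subset_span ?_
  have := Set.finsetSum_mem_finsetSum J Δ (fun k => if k = j then x else 0) fun k _ => by
    by_cases hk : k = j
    · subst hk
      simpa using hx
    · simpa [hk] using h0 k
  simpa [hj] using this

lemma mem_dualAnnihilator_linSum {Δ : Fin r → Set V} (h0 : ∀ i, (0 : V) ∈ Δ i)
    {J : Finset (Fin r)} {y : Module.Dual ℝ V} :
    y ∈ (linSum Δ J).dualAnnihilator ↔ ∀ j ∈ J, ∀ x ∈ Δ j, y x = 0 := by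
  rw [Submodule.mem_dualAnnihilator]
  constructor
  · exact fun h j hj x hx => h x (subset_linSum h0 hj hx)
  · intro h x hx
    refine (Submodule.span_le (p := LinearMap.ker y)).2 (fun x hx => ?_) hx
    obtain ⟨g, hg, rfl⟩ := (Set.mem_finsetSum _ _ _).1 hx
    change y _ = 0
    rw [map_sum]
    exact Finset.sum_eq_zero fun j hj => h j hj _ (hg hj)

/-- The sum contains a positive multiple of every vector, so `y` is nonnegative on both `x` and
`-x`. -/
lemma eq_zero_of_nonneg_on_sum {Δ : Fin r → Set V}
    (hint : (0 : V) ∈ @interior V (moduleTopology ℝ V) (∑ i, Δ i)) {y : Module.Dual ℝ V}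
    (hy : ∀ i, ∀ x ∈ Δ i, 0 ≤ y x) : y = 0 := by
  have hnn : ∀ x, 0 ≤ y x := by
    intro x
    obtain ⟨ε, hε, hx⟩ := exists_pos_smul_mem hint x
    obtain ⟨g, hg, hgx⟩ := (Set.mem_finsetSum _ _ _).1 hx
    have : 0 ≤ y (ε • x) := by
      rw [← hgx, map_sum]
      exact Finset.sum_nonneg fun i hi => hy i _ (hg hi)
    rw [map_smul, smul_eq_mul] at this
    exact nonneg_of_mul_nonneg_right this hε
  ext x
  have := hnn (-x)
  rw [map_neg] at this
  exact le_antisymm (neg_nonneg.1 this) (hnn x)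

/-- The supporting hyperplane through the origin cuts out the smallest face containing the origin,
if every point of the intersection has a negative multiple in it. -/
lemma isLeast_isFace {P : Set V} (l : Module.Dual ℝ V) (hl : ∀ x ∈ P, 0 ≤ l x) (h0 : (0 : V) ∈ P)
    (hneg : ∀ x ∈ {x ∈ P | l x = 0}, ∃ ε : ℝ, 0 < ε ∧ -(ε • x) ∈ P) :
    IsLeast {G | IsFace P G ∧ (0 : V) ∈ G} {x ∈ P | l x = 0} := by
  refine ⟨⟨⟨l, 0, hl, rfl⟩, h0, map_zero l⟩, ?_⟩
  rintro G ⟨⟨m, c, hm, rfl⟩, h0G⟩ x hx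
  have hc : c = 0 := by rw [← h0G.2, map_zero]
  subst hc
  refine ⟨hx.1, le_antisymm ?_ (hm x hx.1)⟩
  obtain ⟨ε, hε, hεx⟩ := hneg x hx
  have := hm _ hεx
  rw [map_neg, map_smul, smul_eq_mul] at this
  by_contra! h
  have := mul_pos hε h
  linarith

/-- The image of a lattice is a lattice if the dual lattice contains the vertices of a polytope with
the origin in its interior. -/
lemma isLattice_map {W : Type*} [AddCommGroup W] [Module ℝ W] [FiniteDimensional ℝ W]
    {L : Submodule ℤ V} (hL : IsLattice L) (p : V →ₗ[ℝ] W) (hp : Function.Surjective p)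
    {P : Set (Module.Dual ℝ W)}
    (hP : IsReflexive (dualLattice (L.map (p.restrictScalars ℤ))) P) :
    IsLattice (L.map (p.restrictScalars ℤ)) := by
  refine isLattice_of_span_dualLattice ?_ ?_
  · obtain ⟨d, b, rfl⟩ := hL
    have : ((Submodule.span ℤ (Set.range b)).map (p.restrictScalars ℤ) : Set W) =
        p '' Submodule.span ℤ (Set.range b) := rfl
    rw [this, Submodule.span_image, Submodule.span_span_of_tower, b.span_eq, Submodule.map_top,
      LinearMap.range_eq_top.2 hp]
  · obtain ⟨S, -, hSL, rfl⟩ := hP.isLatticePolytope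
    rw [eq_top_iff, ← span_eq_top_of_zero_mem_interior hP.zero_mem_interior]
    exact Submodule.span_mono hSL

/-- As `i ∉ J`, forms in `D i` are nonnegative on `Δ^J`, so those killing it form a face, whose
vertices are lattice points. -/
lemma IsCayleyDual.isLatticePolytope_preimage {Δ : Fin r → Set V}
    {D : Fin r → Set (Module.Dual ℝ V)} (h : IsCayleyDual Δ D) {L : Submodule ℤ V}
    (hΔ : ∀ i, IsLatticePolytope L (Δ i)) (hΔ0 : ∀ i, (0 : V) ∈ Δ i)
    (hD : ∀ i, IsLatticePolytope (dualLattice L) (D i))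
    (h0 : ∀ i, (0 : Module.Dual ℝ V) ∈ D i) {J : Finset (Fin r)} {i : Fin r} (hi : i ∉ J) :
    IsLatticePolytope (dualLattice (L.map ((linSum Δ J).mkQ.restrictScalars ℤ)))
      ((linSum Δ J).mkQ.dualMap ⁻¹' D i) := by
  obtain ⟨x₀, hx₀⟩ := exists_test_point hΔ J
  have hnn : ∀ y ∈ D i, ∀ j ∈ J, ∀ x ∈ Δ j, 0 ≤ y x := fun y hy j hj x hx =>
    h.nonneg h0 (ne_of_mem_of_not_mem hj hi) hy hx
  have hface := (hD i).inter_ker (h0 i) (Module.Dual.eval ℝ V x₀)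
    fun y hy => (hx₀ y (hnn y hy)).1
  have hinj := LinearMap.dualMap_injective_of_surjective (linSum Δ J).mkQ_surjective
  have hrange : ∀ y ∈ D i, Module.Dual.eval ℝ V x₀ y = 0 ↔
      y ∈ Set.range (linSum Δ J).mkQ.dualMap := by
    intro y hy
    rw [← LinearMap.coe_range, SetLike.mem_coe, Submodule.range_dualMap_mkQ_eq,
      mem_dualAnnihilator_linSum hΔ0]
    exact (hx₀ y (hnn y hy)).2
  have hpre := hface.preimage (L := dualLattice (L.map ((linSum Δ J).mkQ.restrictScalars ℤ)))
    (linSum Δ J).mkQ.dualMap hinj (fun y hy => (hrange y hy.1).1 hy.2)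
    fun z hz => (dualMap_mem_dualLattice_iff _ z).1 hz
  convert hpre using 1
  ext z
  exact ⟨fun hz => ⟨hz, (hrange _ hz).2 ⟨z, rfl⟩⟩, fun hz => hz.1⟩

end NefPartition

/-! ### The projected nef-partition and its dual -/

open NefPartition in
theorem mainTheorem11 {V : Type*} [AddCommGroup V] [Module ℝ V] [FiniteDimensional ℝ V]
    (L : Submodule ℤ V) (r : ℕ) (Δ : Fin r → Set V) (D : Fin r → Set (Module.Dual ℝ V))
    (hdual : NefPartition.AreDualNefPartitions L Δ D)
    (hproper : NefPartition.IsProper Δ)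
    (I J : Finset (Fin r)) (hIJ : IsCompl I J) (hI : I.Nonempty) (hJ : J.Nonempty)
    (hdim : Module.finrank ℝ (NefPartition.linSum Δ J) < Module.finrank ℝ V)
    (p : V →ₗ[ℝ] V ⧸ NefPartition.linSum Δ J)
    (hp : p = (NefPartition.linSum Δ J).mkQ) :
    -- the projections form a centered nef-partition with respect to the projected lattice
    NefPartition.IsCenteredNefPartition (L.map (p.restrictScalars ℤ)) (fun i => p '' Δ i) ∧
    -- the dual of their sum is a reflexive polytope
    NefPartition.IsReflexive (NefPartition.dualLattice (L.map (p.restrictScalars ℤ)))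
      (NefPartition.dualPolytope (∑ i, p '' Δ i)) ∧
    ∃ F : Set (Module.Dual ℝ V),
      -- `F` is the smallest face of `D_I` containing the origin
      IsLeast {G | NefPartition.IsFace (NefPartition.convUnion D I) G ∧ 0 ∈ G} F ∧
      -- in the dual space of `V` the dual polytope is the intersection of `D_I` with the
      -- annihilator of `Δ^J`, and it is equal to `F`
      p.dualMap '' NefPartition.dualPolytope (∑ i, p '' Δ i) =
        NefPartition.convUnion D I ∩ (NefPartition.linSum Δ J).dualAnnihilator ∧
      NefPartition.convUnion D I ∩ (NefPartition.linSum Δ J).dualAnnihilator = F ∧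
      -- the dual nef-partition consists of the sets `D i ∩ F`, as subsets of the dual space of
      -- the quotient
      NefPartition.AreDualNefPartitions (L.map (p.restrictScalars ℤ)) (fun i => p '' Δ i)
        (fun i => p.dualMap ⁻¹' (D i ∩ F)) := by
  obtain ⟨i₀, hi₀⟩ := hI
  have : Nonempty (Fin r) := ⟨i₀⟩
  have hΔ := hdual.left.isLatticePolytope
  have hΔ0 := hdual.left.zero_mem
  have hD := hdual.right.isLatticePolytope
  have h0 := hdual.right.zero_mem
  have hint := hdual.left.isReflexive_sum.zero_mem_interior
  have h : IsCayleyDual Δ D :=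
    (dual_cayleyCone_eq_iff (fun i => (hD i).convex) h0).1 hdual.dual_cayleyCone
  have hIJ' : ∀ i, i ∉ J ↔ i ∈ I := fun i => by
    rw [← hIJ.compl_eq, Finset.mem_compl, not_not]
  have hps : Function.Surjective p := hp ▸ (linSum Δ J).mkQ_surjective
  have hrange : ∀ y : Module.Dual ℝ V, y ∈ Set.range p.dualMap ↔ y ∈ (linSum Δ J).dualAnnihilator := by
    intro y
    rw [← LinearMap.coe_range, SetLike.mem_coe, hp, Submodule.range_dualMap_mkQ_eq]
  have hpJ : ∀ j ∈ J, ∀ x ∈ Δ j, p x = 0 := fun j hj x hx => by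
    rw [hp, Submodule.mkQ_apply, Submodule.Quotient.mk_eq_zero]
    exact subset_linSum hΔ0 hj hx
  have hpinj : Function.Injective p.dualMap := LinearMap.dualMap_injective_of_surjective hps
  let E : Fin r → Set (Module.Dual ℝ (V ⧸ linSum Δ J)) := fun i => p.dualMap ⁻¹' D i
  -- A form in `D j` that kills `Δ j` is nonnegative on all the `Δ i`, hence zero.
  have hEJ : ∀ j ∈ J, E j = {0} := by
    intro j hj
    refine subset_antisymm (fun z hz => ?_) (by simpa [E] using h0 j)
    refine hpinj ((eq_zero_of_nonneg_on_sum hint fun i x hx => ?_).trans (map_zero _).symm)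
    by_cases hij : i = j
    · subst hij
      simp [hpJ i hj x hx]
    · exact h.nonneg h0 hij hz hx
  have hE : ∀ i, IsLatticePolytope (dualLattice (L.map (p.restrictScalars ℤ))) (E i) := by
    intro i
    by_cases hi : i ∈ J
    · rw [hEJ i hi]
      exact isLatticePolytope_singleton_zero _
    · subst hp
      exact h.isLatticePolytope_preimage hΔ hΔ0 hD h0 hi
  have hE0 : ∀ i, (0 : Module.Dual ℝ (V ⧸ linSum Δ J)) ∈ E i := fun i => by simpa [E] using h0 i
  have hΓ : ∀ i, IsLatticePolytope (L.map (p.restrictScalars ℤ)) (p '' Δ i) := fun i =>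
    (hΔ i).image p fun x hx => ⟨x, hx, rfl⟩
  have hΓ0 : ∀ i, (0 : V ⧸ linSum Δ J) ∈ p '' Δ i := fun i => ⟨0, hΔ0 i, map_zero p⟩
  have hsum : ∑ i, p '' Δ i = p '' ∑ i, Δ i := (Set.image_finsetSum p _ _).symm
  have hΓint : (0 : V ⧸ linSum Δ J) ∈ @interior _ (moduleTopology ℝ (V ⧸ linSum Δ J)) (∑ i, p '' Δ i) := by
    rw [hsum]
    exact image_mem_interior p hps hint
  have hq : IsCayleyDual (fun i => p '' Δ i) E := h.quotient hΔ0 h0 J p hps hpJ fun y hy =>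
    (hrange y).2 ((mem_dualAnnihilator_linSum hΔ0).2 hy)
  -- The reflexive sum of the `E i` has integral vertices spanning the dual space, which makes the
  -- projected subgroup a lattice.
  have hL : IsLattice (L.map (p.restrictScalars ℤ)) :=
    isLattice_map hdual.left.isLattice p hps (hq.isReflexive_sum_right hΓ hΓ0 hE)
  have hquot : AreDualNefPartitions (L.map (p.restrictScalars ℤ)) (fun i => p '' Δ i) E :=
    hq.areDualNefPartitions hL hΓ hΓ0 hE hE0 hΓint
  have hrefl : IsReflexive (dualLattice (L.map (p.restrictScalars ℤ)))
      (dualPolytope (∑ i, p '' Δ i)) :=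
    isReflexive_dualPolytope hquot.left.isReflexive_sum.isLatticePolytope
      (@interior_subset _ (moduleTopology ℝ (V ⧸ linSum Δ J)) _ _ hΓint)
      hquot.left.isReflexive_sum.dual_isLatticePolytope
  have hconv0 : (0 : Module.Dual ℝ V) ∈ convUnion D I :=
    subset_convexHull _ _ (Set.mem_biUnion hi₀ (h0 i₀))
  have hEF : ∀ i, ∀ z ∈ E i, p.dualMap z ∈ convUnion D I ∩ (linSum Δ J).dualAnnihilator := by
    intro i z hz
    refine ⟨?_, (hrange _).1 ⟨z, rfl⟩⟩
    by_cases hi : i ∈ J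
    · rw [hEJ i hi] at hz
      rw [Set.mem_singleton_iff.1 hz, map_zero]
      exact hconv0
    · exact subset_convexHull _ _ (Set.mem_biUnion ((hIJ' i).1 hi) hz)
  have himage : p.dualMap '' dualPolytope (∑ i, p '' Δ i) =
      convUnion D I ∩ (linSum Δ J).dualAnnihilator := by
    apply subset_antisymm
    · rw [hq.dualPolytope_sum hΓ hE0, Set.image_subset_iff]
      refine convexHull_min (Set.iUnion_subset hEF) ?_
      exact ((convex_convexHull ℝ _).inter (linSum Δ J).dualAnnihilator.convex).linear_preimage p.dualMap
    · rintro y ⟨hy, hyK⟩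
      obtain ⟨z, rfl⟩ := (hrange y).2 hyK
      refine ⟨z, ?_, rfl⟩
      -- `D_I` lies in the hull of all the `D i`, which is the dual of the full sum.
      have hmem : p.dualMap z ∈ dualPolytope (∑ i, Δ i) := by
        rw [h.dualPolytope_sum hΔ h0]
        exact convexHull_mono (Set.iUnion₂_subset fun i _ => Set.subset_iUnion D i) hy
      rw [hsum]
      rintro _ ⟨x, hx, rfl⟩
      exact hmem x hx
  refine ⟨hquot.left, hrefl, convUnion D I ∩ (linSum Δ J).dualAnnihilator, ?_, himage, rfl, ?_⟩
  · obtain ⟨x₀, hx₀⟩ := exists_test_point hΔ J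
    have hnn : ∀ y ∈ convUnion D I, ∀ j ∈ J, ∀ x ∈ Δ j, 0 ≤ y x := by
      intro y hy j hj x hx
      refine convexHull_min (t := {y : Module.Dual ℝ V | 0 ≤ Module.Dual.eval ℝ V x y})
        (Set.iUnion₂_subset fun i hi y hy => ?_)
        (convex_halfSpace_ge (Module.Dual.eval ℝ V x).isLinear _) hy
      exact h.nonneg h0 (ne_of_mem_of_not_mem hj ((hIJ' i).2 hi)) hy hx
    have hF : convUnion D I ∩ (linSum Δ J).dualAnnihilator =
        {y ∈ convUnion D I | Module.Dual.eval ℝ V x₀ y = 0} := by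
      ext y
      refine and_congr_right fun hy => ?_
      rw [SetLike.mem_coe, mem_dualAnnihilator_linSum hΔ0]
      exact (hx₀ y (hnn y hy)).2.symm
    rw [hF]
    refine isLeast_isFace _ (fun y hy => (hx₀ y (hnn y hy)).1) hconv0 ?_
    rw [← hF, ← himage]
    rintro _ ⟨z, -, rfl⟩
    -- The origin is interior to the dual polytope of the quotient, so a small multiple of `-z`
    -- stays inside.
    obtain ⟨ε, hε, hz⟩ := exists_pos_smul_mem hrefl.zero_mem_interior (-z)
    refine ⟨ε, hε, ?_⟩
    have hmem := Set.mem_image_of_mem p.dualMap hz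
    rw [himage] at hmem
    simpa using hmem.1
  -- Points of `E i` map into `F` automatically, so intersecting `D i` with `F` changes nothing.
  · convert hquot using 2 with i
    ext z
    exact ⟨fun hz => hz.1, fun hz => ⟨hz, hEF i z hz⟩⟩
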